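/- For $\nu>0$ and $0\le q<1$ let ${\rm NB}(\nu,q)$ denote the distribution on $\{0,1,2,\dots\}$ with weights $\frac{(\nu)_n}{n!}(1-q)^\nu q^n$, where $(\nu)_n=\nu(\nu+1)\cdots(\nu+n-1)$ (so ${\rm NB}(\nu,0)$ is the unit mass at $0$). Proposition. Let $\nu>0$ and $0<q<1$. Let $N,U_1,U_2,\dots$ be independent random variables, where $N$ has distribution ${\rm NB}(\nu,q)$ and each $U_n$ is uniformly distributed on $[0,1]$, and let $$N_t=\#\{1\le n\le N:\ U_n\le t\},\qquad t\in[0,1].$$ Then: (i) For every $t\in[0,1]$, $N_t$ has distribution ${\rm NB}\bigl(\nu,\ \tfrac{qt}{1-q+qt}\bigr)$. (ii) For every $t\in[0,1]$ and every integer $k\ge0$ with $\mathbb P(N_t=k)>0$, the conditional distribution of $N-N_t$ given $N_t=k$ is ${\rm NB}(\nu+k,\ q(1-t))$. (iii) $(N_t,\ t\in[0,1])$ is a Pólya–Lundberg birth process with jump rate $$\lambda_k(t)=\frac{k+\nu}{t+q^{-1}-1}$$ in state $k$ at time $t$. That is, almost surely $N_0=0$ and the path is nondecreasing and right-continuous with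 all jumps of size one; the process is Markov with respect to its natural filtration; and for every $t\in[0,1]$ and $k\ge0$, as $s\to t$ and $u\to t$ with $0\le s\le t\le u\le1$, $s<u$ and $\mathbb P(N_s=k)>0$, $$\mathbb P(N_u=k+1\mid N_s=k)=\lambda_k(t)(u-s)+o(u-s),\qquad \mathbb P(N_u\ge k+2\mid N_s=k)=o(u-s).$$ (iv) $(N_t,\ t\in[0,1])$ is a mixed Poisson process with random rate distributed according to the Gamma distribution $G$ with shape parameter $\nu$ and rate (inverse scale) parameter $q^{-1}-1$. That is, its paths are as in (iii), and its law is the $G$-mixture of the laws of the Poisson processes of rate $r$: for all $0\le t_0\le t_1\le\dots\le t_m\le1$ and all integers $k_1,\dots,k_m\ge0$, $$\mathbb P\bigl(N_{t_i}-N_{t_{i-1}}=k_i,\ i=1,\dots,m\bigr)=\int_0^\infty\prod_{i=1}^m e^{-r(t_i-t_{i-1})}\frac{\bigl(r(t_i-t_{i-1})\bigr)^{k_i}}{k_i!}\,G({\rm d}r).$$ -/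

import Mathlib

open MeasureTheory ProbabilityTheory Filter Topology

noncomputable section

/-- The weight `(ν)_n / n! * (1 - q)^ν * q^n` of the negative binomial distribution at `n`,
where `(ν)_n = ν (ν + 1) ⋯ (ν + n - 1)`. -/
def negBinomialWeight (ν q : ℝ) (n : ℕ) : ℝ :=
  (ascPochhammer ℝ n).eval ν / (n.factorial : ℝ) * (1 - q) ^ ν * q ^ n

/-- The negative binomial distribution `NB(ν, q)` on `ℕ`. For `q = 0` it is the unit mass
at `0`. -/
def negBinomialMeasure (ν q : ℝ) : Measure ℕ :=
  Measure.sum fun n : ℕ => ENNReal.ofReal (negBinomialWeight ν q n) • Measure.dirac n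

/-- The mixed binomial process `N_t = #{n ≤ N : U_n ≤ t}` for `t ∈ [0,1]`. The sequence
`U_1, U_2, …` is indexed from `0`, so the first `N` of its terms have the indices `n < N`. -/
def mixedBinomialProcess {Ω : Type*} (N : Ω → ℕ) (U : ℕ → Ω → ℝ)
    (t : unitInterval) (ω : Ω) : ℕ :=
  ((Finset.range (N ω)).filter fun n => U n ω ≤ (t : ℝ)).card

/-- `N, U_1, U_2, …` are independent random variables, `N` has the law `prior` and each `U_n`
is uniformly distributed on `[0,1]`. -/
structure IsUniformPacing {Ω : Type*} [MeasurableSpace Ω] (P : Measure Ω)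
    (prior : Measure ℕ) (N : Ω → ℕ) (U : ℕ → Ω → ℝ) : Prop where
  measurable_N : Measurable N
  measurable_U : ∀ n, Measurable (U n)
  law_N : HasLaw N prior P
  law_U : ∀ n, pdf.IsUniform (U n) (Set.Icc (0 : ℝ) 1) P
  indep_U : iIndepFun U P
  indep_N_U : IndepFun N (fun ω n => U n ω) P

/-- A simple counting process on `[0,1]`: it starts at `0` and almost every path is
nondecreasing and right-continuous with jumps of size one. -/
structure IsSimpleCountingProcess {Ω : Type*} [MeasurableSpace Ω]
    (X : unitInterval → Ω → ℕ) (P : Measure Ω) : Prop where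
  measurable : ∀ t, Measurable (X t)
  start : ∀ᵐ ω ∂P, X 0 ω = 0
  mono : ∀ᵐ ω ∂P, Monotone fun t => X t ω
  rightCont : ∀ᵐ ω ∂P, ∀ t, ContinuousWithinAt (fun t => X t ω) (Set.Ici t) t
  unitJumps : ∀ᵐ ω ∂P, ∀ t, 0 < t → ∃ s, s < t ∧ X t ω ≤ X s ω + 1

/-- The `σ`-algebra generated by `X r`, `r ≤ s`. -/
abbrev pastSigma {Ω : Type*} (X : unitInterval → Ω → ℕ) (s : unitInterval) : MeasurableSpace Ω :=
  ⨆ r : Set.Iic s, MeasurableSpace.comap (X r) ⊤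

/-- The pairs of times `s ≤ t ≤ u`, `s < u`, for which the state `k` at time `s` has
positive probability. -/
def timesAround {Ω : Type*} [MeasurableSpace Ω] (X : unitInterval → Ω → ℕ) (P : Measure Ω)
    (k : ℕ) (t : unitInterval) : Set (unitInterval × unitInterval) :=
  {p | p.1 ≤ t ∧ t ≤ p.2 ∧ p.1 < p.2 ∧ P {ω | X p.1 ω = k} ≠ 0}

/-- `X` is a (time-inhomogeneous, pure) birth process on `[0,1]`, started at `0`, with jump
rate `rate t k` in state `k` at time `t`: a simple counting process with the Markov property
and the infinitesimal transition probabilities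
`P(X_u = k + 1 | X_s = k) = rate t k * (u - s) + o(u - s)` and
`P(X_u ≥ k + 2 | X_s = k) = o(u - s)` as `s ↑ t` and `u ↓ t`. -/
structure IsBirthProcess {Ω : Type*} [MeasurableSpace Ω] (X : unitInterval → Ω → ℕ)
    (rate : ℝ → ℕ → ℝ) (P : Measure Ω) : Prop where
  counting : IsSimpleCountingProcess X P
  markov : ∀ s t : unitInterval, s ≤ t → ∀ j : ℕ,
    P⟦{ω | X t ω = j} | pastSigma X s⟧ =ᵐ[P]
      P⟦{ω | X t ω = j} | MeasurableSpace.comap (X s) ⊤⟧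
  rate_one : ∀ (t : unitInterval) (k : ℕ),
    Tendsto (fun p : unitInterval × unitInterval =>
        (cond P {ω | X p.1 ω = k}).real {ω | X p.2 ω = k + 1} / ((p.2 : ℝ) - (p.1 : ℝ)))
      (𝓝[timesAround X P k t] (t, t)) (𝓝 (rate t k))
  rate_more : ∀ (t : unitInterval) (k : ℕ),
    Tendsto (fun p : unitInterval × unitInterval =>
        (cond P {ω | X p.1 ω = k}).real {ω | k + 2 ≤ X p.2 ω} / ((p.2 : ℝ) - (p.1 : ℝ)))
      (𝓝[timesAround X P k t] (t, t)) (𝓝 0)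

/-- `X` is a mixed Poisson process on `[0,1]` whose random rate has the distribution `G` (a
probability measure on `[0,∞)`): a simple counting process whose law is the `G`-mixture over
`r` of the laws of the Poisson processes with rate `r`. That is, conditionally on the rate
being `r`, increments over successive intervals are independent and Poisson distributed with
mean `r` times the length of the interval. -/
structure IsMixedPoissonProcess {Ω : Type*} [MeasurableSpace Ω] (X : unitInterval → Ω → ℕ)
    (G : Measure ℝ) (P : Measure Ω) : Prop where
  counting : IsSimpleCountingProcess X P
  rate_prob : IsProbabilityMeasure G
  rate_nonneg : ∀ᵐ r ∂G, 0 ≤ r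
  increments : ∀ (m : ℕ) (τ : Fin (m + 1) → unitInterval), Monotone τ → ∀ k : Fin m → ℕ,
    P {ω | ∀ i, X (τ i.succ) ω = X (τ i.castSucc) ω + k i} =
      ∫⁻ r, ∏ i, poissonMeasure
        (r * ((τ i.succ : ℝ) - (τ i.castSucc : ℝ))).toNNReal {k i} ∂G

end

/-! Everything rests on one fact: with `b = q⁻¹ - 1`, NB(ν, q) is the Gamma(ν, b) mixture over `r`
of the Poisson laws of mean `r`. A Poisson number of independent uniform points has independent
Poisson counts in disjoint cells (`measure_card_filter_range_eq_lintegral`). This splitting survives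
mixing over `r`, so `IsUniformPacing.measure_increments` yields the mixed Poisson property (iv).

The other claims follow from (iv) alone. For given increments, the Poisson product depends on `r`
only through the elapsed time `T` and the total count `K`, so integrating out the Gamma rate leaves
the factor `gammaMoment a b T K`. By `gammaMoment_add`, appending one more increment multiplies the
probability by a negative binomial weight that depends only on the current time and state. This is
the Markov property on finite grids (`measure_path_inter`), with transition law NB(ν + k, (t - s)/(b
+ t)) from state `k`; a π-system argument extends it to the whole past
(`measure_inter_eq_setLIntegral`). Claim (i) is the one-increment case from time `0`, (ii) is the
transition to time `1`, where N_1 = N almost surely, and the rates in (iii) come from expanding the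
transition weights as the two times merge. -/

/-! ### Multinomial counts and the Poisson law. -/

/-- The multinomial theorem, coefficient by coefficient: the words of length `n` in which the
letter `i` occurs `k i` times have the total weight given by the multinomial coefficient. -/
theorem sum_prod_of_card_fiber_eq {ι R : Type*} [Fintype ι] [DecidableEq ι] [CommSemiring R]
    (p : ι → R) (k : ι → ℕ) {n : ℕ} (hn : ∑ i, k i = n) :
    ∑ f : Fin n → ι with (∀ i, (Finset.univ.filter fun j => f j = i).card = k i), ∏ j, p (f j) =
      (Nat.multinomial Finset.univ k : R) * ∏ i, p i ^ k i := by
  -- The coefficient of the monomial with exponents `k` in `(∑ p i X i) ^ n` is computed twice: in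
  -- closed form, and by expanding the power over all words.
  have h := MvPolynomial.coeff_linearCombination_X_pow_of_fintype p
    (Finsupp.equivFunOnFinite.symm k) n
  have h1 : ((Finsupp.equivFunOnFinite.symm k).sum fun _ m => m) = n := by
    rw [Finsupp.sum_fintype _ _ (by simp)]
    simpa using hn
  rw [if_pos h1, Finsupp.prod_fintype _ _ (by simp),
    ← Finsupp.multinomial_of_support_subset (Finset.subset_univ _), Finset.sum_pow',
    MvPolynomial.coeff_sum] at h
  simp only [Finsupp.coe_equivFunOnFinite_symm, Fintype.piFinset_univ] at h
  rw [← h, Finset.sum_filter]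
  refine Finset.sum_congr rfl fun f _ => ?_
  have h2 : ∏ j, p (f j) • (MvPolynomial.X (f j) : MvPolynomial ι R) =
      MvPolynomial.monomial (∑ j, Finsupp.single (f j) 1) (∏ j, p (f j)) := by
    rw [MvPolynomial.monomial_sum_prod]
    refine Finset.prod_congr rfl fun j _ => ?_
    rw [MvPolynomial.X, MvPolynomial.smul_monomial, smul_eq_mul, mul_one]
  rw [h2, MvPolynomial.coeff_monomial]
  congr 1
  simp only [Finsupp.ext_iff, eq_iff_iff]
  refine forall_congr' fun i => ?_
  simp [Finsupp.finsetSum_apply, Finsupp.single_apply, Finset.sum_boole]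

/-- Poisson splitting: the factorial of the total cancels against the multinomial coefficient, and
the exponential factors over the cells because the `p i` sum to one. -/
theorem poissonMeasure_mul_multinomial {ι : Type*} [Fintype ι] (p : ι → NNReal)
    (hp : ∑ i, p i = 1) (k : ι → ℕ) (r : NNReal) :
    poissonMeasure r {∑ i, k i} *
      ((Nat.multinomial Finset.univ k : ENNReal) * ∏ i, (p i : ENNReal) ^ k i) =
      ∏ i, poissonMeasure (r * p i) {k i} := by
  simp only [poissonMeasure_singleton]
  rw [← ENNReal.ofReal_prod_of_nonneg (fun i _ => by positivity)]
  have h1 : ((Nat.multinomial Finset.univ k : ENNReal) * ∏ i, (p i : ENNReal) ^ k i) =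
      ENNReal.ofReal ((Nat.multinomial Finset.univ k : ℝ) * ∏ i, (p i : ℝ) ^ k i) := by
    rw [ENNReal.ofReal_mul (by positivity), ENNReal.ofReal_natCast,
      ENNReal.ofReal_prod_of_nonneg (fun i _ => by positivity)]
    congr 1
    refine Finset.prod_congr rfl fun i _ => ?_
    rw [ENNReal.ofReal_pow (by positivity), ENNReal.ofReal_coe_nnreal]
  rw [h1, ← ENNReal.ofReal_mul (by positivity)]
  congr 1
  have h2 : ((∏ i, (k i).factorial : ℕ) : ℝ) * (Nat.multinomial Finset.univ k : ℝ) =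
      ((∑ i, k i).factorial : ℝ) := by
    exact_mod_cast Nat.multinomial_spec Finset.univ k
  have h3 : ∏ i, Real.exp (-(↑(r * p i) : ℝ)) = Real.exp (-(r : ℝ)) := by
    rw [← Real.exp_sum]
    congr 1
    have : (∑ i, (p i : ℝ)) = 1 := by exact_mod_cast hp
    simp only [NNReal.coe_mul, Finset.sum_neg_distrib, ← Finset.mul_sum, this, mul_one]
  rw [Finset.prod_div_distrib, Finset.prod_mul_distrib, h3]
  simp only [NNReal.coe_mul, mul_pow, Finset.prod_mul_distrib]
  rw [Finset.prod_pow_eq_pow_sum, ← h2]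
  push_cast
  have h4 : (∏ i, ((k i).factorial : ℝ)) ≠ 0 := by positivity
  have h5 : (Nat.multinomial Finset.univ k : ℝ) ≠ 0 := by
    exact_mod_cast (Nat.multinomial_pos Finset.univ k).ne'
  field_simp

/-! ### Gamma mixtures of Poisson weights. -/

/-- The mixture over a `Gamma(a, b)`-distributed rate `r` of the weights `exp (-T r) r ^ K`. -/
noncomputable def gammaMoment (a b T : ℝ) (K : ℕ) : ℝ :=
  b ^ a / Real.Gamma a * (Real.Gamma (a + K) / (b + T) ^ (a + K))

theorem gammaMoment_pos {a b T : ℝ} (ha : 0 < a) (hb : 0 < b) (hT : 0 ≤ T) (K : ℕ) :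
    0 < gammaMoment a b T K := by
  have h1 := Real.Gamma_pos_of_pos ha
  have h2 : 0 < Real.Gamma (a + K) := Real.Gamma_pos_of_pos (by positivity)
  unfold gammaMoment
  positivity

/-- Conjugacy: tilting the Gamma(a, b) density by the integrand gives a multiple of the Gamma(a + K,
b + T) density, which has total mass one. -/
theorem lintegral_gammaMeasure_exp_mul_pow {a b T : ℝ} (ha : 0 < a) (hb : 0 < b) (hT : 0 ≤ T)
    (K : ℕ) :
    ∫⁻ r, ENNReal.ofReal (Real.exp (-(T * r)) * r ^ K) ∂gammaMeasure a b =
      ENNReal.ofReal (gammaMoment a b T K) := by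
  have haK : 0 < a + K := by positivity
  have hbT : 0 < b + T := by positivity
  rw [gammaMeasure, lintegral_withDensity_eq_lintegral_mul _ (by unfold gammaPDF; fun_prop)
    (by fun_prop)]
  have h1 : ∀ᵐ r : ℝ, (gammaPDF a b * fun r => ENNReal.ofReal (Real.exp (-(T * r)) * r ^ K)) r =
      ENNReal.ofReal (gammaMoment a b T K) * gammaPDF (a + K) (b + T) r := by
    -- The point `r = 0` is discarded because splitting the real power below needs `0 < r`.
    have h0 : ∀ᵐ r : ℝ, r ≠ 0 := by simp [ae_iff]
    filter_upwards [h0] with r hr0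
    rcases lt_or_gt_of_ne hr0 with hr | hr
    · simp [gammaPDF_of_neg hr]
    · simp only [Pi.mul_apply]
      rw [gammaPDF_of_nonneg hr.le, gammaPDF_of_nonneg hr.le,
        ← ENNReal.ofReal_mul (by have := Real.Gamma_pos_of_pos ha; positivity),
        ← ENNReal.ofReal_mul (gammaMoment_pos ha hb hT K).le]
      congr 1
      have h2 : Real.Gamma (a + K) ≠ 0 := (Real.Gamma_pos_of_pos haK).ne'
      have h3 : r ^ (a + K - 1) = r ^ (a - 1) * r ^ K := by
        rw [← Real.rpow_natCast, ← Real.rpow_add hr]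
        ring_nf
      have h4 : Real.exp (-((b + T) * r)) = Real.exp (-(b * r)) * Real.exp (-(T * r)) := by
        rw [← Real.exp_add]
        ring_nf
      have h5 : (b + T) ^ (a + K) ≠ 0 := (Real.rpow_pos_of_pos hbT _).ne'
      rw [gammaMoment, h3, h4]
      field_simp
  rw [lintegral_congr_ae h1, lintegral_const_mul _ (by unfold gammaPDF; fun_prop),
    lintegral_gammaPDF_eq_one haK hbT, mul_one]

theorem ae_nonneg_gammaMeasure (a b : ℝ) : ∀ᵐ r ∂gammaMeasure a b, 0 ≤ r := by
  rw [ae_iff, gammaMeasure, withDensity_apply _ (by measurability)]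
  simp only [not_le]
  exact lintegral_gammaPDF_of_nonpos le_rfl

/-- Total length and total count are sufficient statistics for the rate: the last factor is free of
`r`. This separation is the source of the Markov property. -/
theorem prod_poissonMeasure_singleton {ι : Type*} [Fintype ι] {p : ι → ℝ} (hp : ∀ i, 0 ≤ p i)
    (k : ι → ℕ) {r : ℝ} (hr : 0 ≤ r) :
    ∏ i, poissonMeasure (r * p i).toNNReal {k i} =
      ENNReal.ofReal (Real.exp (-((∑ i, p i) * r)) * r ^ ∑ i, k i) *
        ENNReal.ofReal (∏ i, p i ^ k i / (k i).factorial) := by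
  simp only [poissonMeasure_singleton]
  rw [← ENNReal.ofReal_prod_of_nonneg (fun i _ => by positivity),
    ← ENNReal.ofReal_mul (by positivity)]
  congr 1
  have h (i : ι) : (((r * p i).toNNReal : NNReal) : ℝ) = r * p i :=
    Real.coe_toNNReal _ (mul_nonneg hr (hp i))
  simp only [h, mul_pow, Finset.prod_mul_distrib, Finset.prod_div_distrib,
    Finset.prod_pow_eq_pow_sum, ← Real.exp_sum, Finset.sum_neg_distrib, ← Finset.mul_sum]
  rw [mul_comm r (∑ i, p i)]
  ring

theorem lintegral_prod_poissonMeasure_gammaMeasure {ι : Type*} [Fintype ι] {a b : ℝ} (ha : 0 < a)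
    (hb : 0 < b) {p : ι → ℝ} (hp : ∀ i, 0 ≤ p i) (k : ι → ℕ) :
    ∫⁻ r, ∏ i, poissonMeasure (r * p i).toNNReal {k i} ∂gammaMeasure a b =
      ENNReal.ofReal (gammaMoment a b (∑ i, p i) (∑ i, k i) *
        ∏ i, p i ^ k i / (k i).factorial) := by
  have h : ∀ᵐ r ∂gammaMeasure a b, ∏ i, poissonMeasure (r * p i).toNNReal {k i} =
      ENNReal.ofReal (Real.exp (-((∑ i, p i) * r)) * r ^ ∑ i, k i) *
        ENNReal.ofReal (∏ i, p i ^ k i / (k i).factorial) := by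
    filter_upwards [ae_nonneg_gammaMeasure a b] with r hr
    exact prod_poissonMeasure_singleton hp k hr
  have hs : 0 ≤ ∑ i, p i := Finset.sum_nonneg fun i _ => hp i
  rw [lintegral_congr_ae h, lintegral_mul_const _ (by fun_prop),
    lintegral_gammaMeasure_exp_mul_pow ha hb hs,
    ← ENNReal.ofReal_mul (gammaMoment_pos ha hb hs _).le]

theorem lintegral_poissonMeasure_gammaMeasure {a b T : ℝ} (ha : 0 < a) (hb : 0 < b) (hT : 0 ≤ T)
    (n : ℕ) :
    ∫⁻ r, poissonMeasure (r * T).toNNReal {n} ∂gammaMeasure a b =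
      ENNReal.ofReal (gammaMoment a b T n * (T ^ n / n.factorial)) := by
  simpa using lintegral_prod_poissonMeasure_gammaMeasure (ι := Unit) ha hb
    (p := fun _ => T) (fun _ => hT) (fun _ => n)

theorem negBinomialMeasure_singleton (a q : ℝ) (n : ℕ) :
    negBinomialMeasure a q {n} = ENNReal.ofReal (negBinomialWeight a q n) :=
  Measure.sum_smul_dirac_singleton

theorem Gamma_add_natCast {a : ℝ} (ha : 0 < a) (n : ℕ) :
    Real.Gamma (a + n) = (ascPochhammer ℝ n).eval a * Real.Gamma a := by
  induction n with
  | zero => simp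
  | succ n ih =>
    have h : (0 : ℝ) < a + n := by positivity
    rw [Nat.cast_succ, ← add_assoc, Real.Gamma_add_one h.ne', ih, ascPochhammer_succ_eval]
    ring

/-- The transition weights of the mixed process: the ratio of two Gamma mixtures is a negative
binomial weight. -/
theorem gammaMoment_add {a b s d : ℝ} (ha : 0 < a) (hb : 0 < b) (hs : 0 ≤ s) (hd : 0 ≤ d)
    (k j : ℕ) :
    gammaMoment a b (s + d) (k + j) * (d ^ j / j.factorial) =
      gammaMoment a b s k * negBinomialWeight (a + k) (d / (b + s + d)) j := by
  have hbs : 0 < b + s := by positivity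
  have hbd : 0 < b + s + d := by positivity
  have hak : 0 < a + k := by positivity
  -- Given `k` points by time `s`, the rate is Gamma(a + k, b + s) distributed; the identity is the
  -- Gamma–Poisson mixture with these updated parameters.
  have h1 : 1 - d / (b + s + d) = (b + s) / (b + s + d) := by field_simp; ring
  have h2 := Gamma_add_natCast hak j
  have h3 : (b + (s + d)) ^ (a + ↑(k + j)) = (b + s + d) ^ (a + k) * (b + s + d) ^ j := by
    rw [← Real.rpow_natCast, ← Real.rpow_add hbd]
    push_cast
    ring_nf
  have h4 : (b + s) ^ (a + k) ≠ 0 := (Real.rpow_pos_of_pos hbs _).ne'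
  have h5 : (b + s + d) ^ (a + k) ≠ 0 := (Real.rpow_pos_of_pos hbd _).ne'
  rw [negBinomialWeight, h1, Real.div_rpow hbs.le hbd.le, gammaMoment, gammaMoment, h3,
    Nat.cast_add, ← add_assoc, h2, div_pow]
  have h6 : Real.Gamma a ≠ 0 := (Real.Gamma_pos_of_pos ha).ne'
  field_simp

theorem gammaMoment_zero_zero {a b : ℝ} (ha : 0 < a) (hb : 0 < b) : gammaMoment a b 0 0 = 1 := by
  have h6 : Real.Gamma a ≠ 0 := (Real.Gamma_pos_of_pos ha).ne'
  have h5 : b ^ a ≠ 0 := (Real.rpow_pos_of_pos hb _).ne'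
  simp only [gammaMoment, Nat.cast_zero, add_zero]
  field_simp

/-- The negative binomial distribution is the Gamma mixture of Poisson distributions. -/
theorem negBinomialWeight_eq_gammaMoment {a b T : ℝ} (ha : 0 < a) (hb : 0 < b) (hT : 0 ≤ T)
    (n : ℕ) :
    negBinomialWeight a (T / (b + T)) n = gammaMoment a b T n * (T ^ n / n.factorial) := by
  simpa [gammaMoment_zero_zero ha hb] using (gammaMoment_add ha hb le_rfl hT 0 n).symm

/-! ### Counting independent random letters. -/

/-- The multinomial distribution of the letter counts of `n` independent random letters. -/
theorem measure_card_filter_range_eq {Ω ι : Type*} [MeasurableSpace Ω] {P : Measure Ω}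
    [Fintype ι] [DecidableEq ι] [MeasurableSpace ι] [MeasurableSingletonClass ι]
    {L : ℕ → Ω → ι} (hL : ∀ n, Measurable (L n)) (hind : iIndepFun L P) {p : ι → ENNReal}
    (hp : ∀ n i, P {ω | L n ω = i} = p i) (k : ι → ℕ) {n : ℕ} (hn : ∑ i, k i = n) :
    P {ω | ∀ i, ((Finset.range n).filter fun j => L j ω = i).card = k i} =
      (Nat.multinomial Finset.univ k : ENNReal) * ∏ i, p i ^ k i := by
  classical
  rw [← sum_prod_of_card_fiber_eq p k hn]
  -- The event splits disjointly according to the word spelled by the first `n` letters.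
  have h1 : {ω | ∀ i, ((Finset.range n).filter fun j => L j ω = i).card = k i} =
      ⋃ f ∈ (Finset.univ.filter fun f : Fin n → ι =>
        ∀ i, (Finset.univ.filter fun j => f j = i).card = k i), ⋂ j : Fin n, {ω | L j ω = f j} := by
    ext ω
    have hc : ∀ i, ((Finset.range n).filter fun j => L j ω = i).card =
        (Finset.univ.filter fun j : Fin n => L j ω = i).card := fun i => by
      rw [Finset.card_filter, Finset.card_filter, Finset.sum_range]
    simp only [Set.mem_ofPred_eq, hc, Set.mem_iUnion, Finset.mem_filter, Finset.mem_univ, true_and,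
      Set.mem_iInter, exists_prop]
    constructor
    · intro h
      exact ⟨fun j => L j ω, h, fun _ => rfl⟩
    · rintro ⟨f, hf, h⟩
      simpa only [h] using hf
  have hm : ∀ (n : ℕ) (i : ι), MeasurableSet {ω | L n ω = i} := fun n i =>
    hL n (measurableSet_singleton i)
  rw [h1, measure_biUnion_finset]
  · refine Finset.sum_congr rfl fun f _ => ?_
    have h2 := (hind.precomp (Fin.val_injective (n := n))).meas_iInter
      (s := fun j : Fin n => {ω | L j ω = f j}) fun j => ⟨{f j}, measurableSet_singleton _, rfl⟩
    rw [h2]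
    exact Finset.prod_congr rfl fun j _ => hp _ _
  · intro f _ g _ hfg
    refine Set.disjoint_left.2 fun ω hf hg => hfg ?_
    simp only [Set.mem_iInter, Set.mem_ofPred_eq] at hf hg
    exact funext fun j => (hf j).symm.trans (hg j)
  · exact fun f _ => MeasurableSet.iInter fun j => hm _ _

/-- Poisson thinning for a mixed Poisson number of independent random letters. -/
theorem measure_card_filter_range_eq_lintegral {Ω ι : Type*} [MeasurableSpace Ω] {P : Measure Ω}
    [Fintype ι] [DecidableEq ι] [MeasurableSpace (Option ι)] [MeasurableSingletonClass (Option ι)]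
    {N : Ω → ℕ} {L : ℕ → Ω → Option ι} (hN : Measurable N) (hL : ∀ n, Measurable (L n))
    (hind : iIndepFun L P) (hNL : IndepFun N (fun ω n => L n ω) P) {p : Option ι → NNReal}
    (hp : ∀ n i, P {ω | L n ω = i} = p i) (hp1 : ∑ i, p i = 1) {G : Measure ℝ}
    (hG : ∀ n, P {ω | N ω = n} = ∫⁻ r, poissonMeasure r.toNNReal {n} ∂G) (k : ι → ℕ) :
    P {ω | ∀ i, ((Finset.range (N ω)).filter fun j => L j ω = some i).card = k i} =
      ∫⁻ r, ∏ i, poissonMeasure (r.toNNReal * p (some i)) {k i} ∂G := by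
  -- The letter `none` marks points outside all cells. Its count `l` is unconstrained, so the event
  -- is decomposed over `l`, which fixes `N` as `l + ∑ i, k i`.
  let k' : ℕ → Option ι → ℕ := fun l i => i.elim l k
  have hk' : ∀ l, ∑ i, k' l i = l + ∑ i, k i := fun l => by simp [k', Fintype.sum_option]
  let A : ℕ → Set (ℕ → Option ι) := fun l =>
    {x | ∀ i, ((Finset.range (l + ∑ i, k i)).filter fun j => x j = i).card = k' l i}
  have hA : ∀ l, MeasurableSet (A l) := fun l => by
    have : A l = ⋂ i, {x : ℕ → Option ι | ∑ j ∈ Finset.range (l + ∑ i, k i),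
        (if x j = i then 1 else 0) = k' l i} := by
      ext x; simp only [A, Finset.card_filter, Set.mem_ofPred_eq, Set.mem_iInter]
    rw [this]
    refine MeasurableSet.iInter fun i => ?_
    have hmeas : Measurable fun x : ℕ → Option ι =>
        ∑ j ∈ Finset.range (l + ∑ i, k i), (if x j = i then 1 else 0) := by
      refine Finset.measurable_sum _ fun j _ => ?_
      exact Measurable.ite (measurableSet_eq_fun (measurable_pi_apply j) measurable_const)
        measurable_const measurable_const
    exact hmeas (measurableSet_singleton _)
  have hcount : ∀ ω, (∀ i, ((Finset.range (N ω)).filter fun j => L j ω = some i).card = k i) →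
      N ω = ((Finset.range (N ω)).filter fun j => L j ω = none).card + ∑ i, k i := by
    intro ω h
    have h1 := Finset.card_eq_sum_card_fiberwise (s := Finset.range (N ω))
      (t := Finset.univ) (f := fun j => L j ω) (fun _ _ => Finset.mem_univ _)
    rw [Finset.card_range, Fintype.sum_option] at h1
    simpa only [h] using h1
  have hunion : {ω | ∀ i, ((Finset.range (N ω)).filter fun j => L j ω = some i).card = k i} =
      ⋃ l, (N ⁻¹' {l + ∑ i, k i} ∩ (fun ω n => L n ω) ⁻¹' A l) := by
    ext ω
    simp only [Set.mem_ofPred_eq, Set.mem_iUnion, Set.mem_inter_iff, Set.mem_preimage,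
      Set.mem_singleton_iff, A]
    constructor
    · intro h
      refine ⟨_, hcount ω h, fun i => ?_⟩
      rw [← hcount ω h]
      cases i with
      | none => rfl
      | some i => exact h i
    · rintro ⟨l, hl, h⟩ i
      rw [hl]
      exact h (some i)
  rw [hunion, measure_iUnion]
  · have hterm : ∀ l, P (N ⁻¹' {l + ∑ i, k i} ∩ (fun ω n => L n ω) ⁻¹' A l) =
        ∫⁻ r, (∏ i, poissonMeasure (r.toNNReal * p (some i)) {k i}) *
          poissonMeasure (r.toNNReal * p none) {l} ∂G := by
      intro l
      rw [hNL.measure_inter_preimage_eq_mul _ _ (measurableSet_singleton _) (hA l)]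
      have h1 : P ((fun ω n => L n ω) ⁻¹' A l) = _ :=
        measure_card_filter_range_eq hL hind hp (k' l) (hk' l)
      have h2 : P (N ⁻¹' {l + ∑ i, k i}) = _ := hG (l + ∑ i, k i)
      have hfin : (Nat.multinomial Finset.univ (k' l) : ENNReal) * ∏ i, (p i : ENNReal) ^ k' l i ≠
          ⊤ := ENNReal.mul_ne_top (ENNReal.natCast_ne_top _)
        (ENNReal.prod_ne_top fun i _ => ENNReal.pow_ne_top ENNReal.coe_ne_top)
      rw [h1, h2, ← lintegral_mul_const' _ _ hfin]
      refine lintegral_congr fun r => ?_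
      rw [← hk' l, poissonMeasure_mul_multinomial p hp1, Fintype.prod_option, mul_comm]
      rfl
    simp only [hterm]
    have hmeas : ∀ (c : NNReal) (n : ℕ),
        Measurable fun r : ℝ => poissonMeasure (r.toNNReal * c) {n} := fun c n => by
      simp only [poissonMeasure_singleton]
      fun_prop
    rw [← lintegral_tsum]
    · refine lintegral_congr fun r => ?_
      rw [ENNReal.tsum_mul_left]
      -- Summing out the count of `none` leaves the total mass of a Poisson law.
      have h3 : ∑' l, poissonMeasure (r.toNNReal * p none) {l} = 1 := by
        simpa using (poissonMeasure (r.toNNReal * p none)).tsum_indicator_apply_singleton Set.univ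
          MeasurableSet.univ
      rw [h3, mul_one]
    · intro l
      exact ((Finset.univ.measurable_prod fun i _ => hmeas _ _).mul (hmeas _ _)).aemeasurable
  · intro l l' hll'
    refine Set.disjoint_left.2 fun ω h h' => hll' ?_
    have h1 : N ω = l + ∑ i, k i := h.1
    have h2 : N ω = l' + ∑ i, k i := h'.1
    omega
  · exact fun l => (hN (measurableSet_singleton _)).inter
      (measurable_pi_lambda _ hL (hA l))

/-! ### Cells of a time grid and the counting process. -/

/-- The index of the cell `(τ i, τ (i + 1)]` that contains `x`, if there is one. -/
noncomputable def cellIndex {m : ℕ} (τ : Fin (m + 1) → unitInterval) (x : ℝ) : Option (Fin m) :=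
  open Classical in
  if h : ∃ i : Fin m, (τ i.castSucc : ℝ) < x ∧ x ≤ (τ i.succ : ℝ) then some h.choose else none

/-- Half-open cells of a monotone grid are disjoint, so the choice in `cellIndex` is forced;
repeated grid points merely give empty cells. -/
theorem cellIndex_eq_some {m : ℕ} {τ : Fin (m + 1) → unitInterval} (hτ : Monotone τ) {x : ℝ}
    {i : Fin m} :
    cellIndex τ x = some i ↔ (τ i.castSucc : ℝ) < x ∧ x ≤ (τ i.succ : ℝ) := by
  have huniq : ∀ i j : Fin m, (τ i.castSucc : ℝ) < x ∧ x ≤ (τ i.succ : ℝ) →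
      (τ j.castSucc : ℝ) < x ∧ x ≤ (τ j.succ : ℝ) → j ≤ i := by
    intro i j hi hj
    by_contra! hij
    have h1 : τ i.succ ≤ τ j.castSucc := hτ (Fin.succ_le_castSucc_iff.2 hij)
    have h2 : (τ i.succ : ℝ) ≤ τ j.castSucc := h1
    linarith [hi.2, hj.1]
  unfold cellIndex
  split_ifs with h
  · rw [Option.some_inj]
    refine ⟨fun hi => hi ▸ h.choose_spec, fun hi => ?_⟩
    exact le_antisymm (huniq _ _ hi h.choose_spec) (huniq _ _ h.choose_spec hi)
  · exact ⟨fun hi => by simp at hi, fun hi => (h ⟨i, hi⟩).elim⟩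

theorem measurableSet_cellIndex_preimage {m : ℕ} {τ : Fin (m + 1) → unitInterval}
    (hτ : Monotone τ) (i : Option (Fin m)) : MeasurableSet (cellIndex τ ⁻¹' {i}) := by
  have hsome : ∀ i : Fin m, MeasurableSet (cellIndex τ ⁻¹' {some i}) := fun i => by
    have : cellIndex τ ⁻¹' {some i} = Set.Ioc (τ i.castSucc : ℝ) (τ i.succ) := by
      ext x
      exact cellIndex_eq_some hτ
    rw [this]
    exact measurableSet_Ioc
  cases i with
  | some i => exact hsome i
  | none =>
    have : cellIndex τ ⁻¹' {none} = (⋃ i : Fin m, cellIndex τ ⁻¹' {some i})ᶜ := by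
      ext x
      simp [Option.eq_none_iff_forall_ne_some]
    rw [this]
    exact (MeasurableSet.iUnion hsome).compl

theorem mixedBinomialProcess_eq_add {Ω : Type*} (N : Ω → ℕ) (U : ℕ → Ω → ℝ)
    {s t : unitInterval} (hst : s ≤ t) (ω : Ω) :
    mixedBinomialProcess N U t ω = mixedBinomialProcess N U s ω +
      ((Finset.range (N ω)).filter fun n => (s : ℝ) < U n ω ∧ U n ω ≤ (t : ℝ)).card := by
  have hst' : (s : ℝ) ≤ t := hst
  unfold mixedBinomialProcess
  rw [← Finset.card_union_of_disjoint]
  · congr 1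
    ext n
    simp only [Finset.mem_filter, Finset.mem_union, Finset.mem_range]
    constructor
    · rintro ⟨h1, h2⟩
      rcases le_or_gt (U n ω) s with h | h
      · exact Or.inl ⟨h1, h⟩
      · exact Or.inr ⟨h1, h, h2⟩
    · rintro (⟨h1, h2⟩ | ⟨h1, -, h2⟩)
      · exact ⟨h1, h2.trans hst'⟩
      · exact ⟨h1, h2⟩
  · refine Finset.disjoint_filter.2 fun n _ h1 h2 => ?_
    linarith [h2.1]

theorem monotone_mixedBinomialProcess {Ω : Type*} (N : Ω → ℕ) (U : ℕ → Ω → ℝ) (ω : Ω) :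
    Monotone fun t => mixedBinomialProcess N U t ω := fun s t hst => by
  simp only [mixedBinomialProcess_eq_add N U hst ω, Nat.le_add_right]

/-! ### Uniform points: paths and increments. -/

namespace IsUniformPacing

variable {Ω : Type*} [MeasurableSpace Ω] {P : Measure Ω} {prior : Measure ℕ} {N : Ω → ℕ}
  {U : ℕ → Ω → ℝ}

theorem measure_preimage (h : IsUniformPacing P prior N U) (n : ℕ) {B : Set ℝ}
    (hB : MeasurableSet B) :
    P (U n ⁻¹' B) = (volume.restrict (Set.Icc (0 : ℝ) 1)) B := by
  rw [(h.law_U n).measure_preimage (by simp) (by simp) hB, Measure.restrict_apply hB,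
    Set.inter_comm]
  simp

/-- Excluding the endpoint `0` makes the process start at `0`; the bound by `1` makes its value at
time `1` equal to `N`. -/
theorem ae_mem_Ioc (h : IsUniformPacing P prior N U) :
    ∀ᵐ ω ∂P, ∀ n, 0 < U n ω ∧ U n ω ≤ 1 := by
  rw [ae_all_iff]
  intro n
  have h1 := h.measure_preimage n (B := (Set.Ioc (0 : ℝ) 1)ᶜ) measurableSet_Ioc.compl
  rw [Measure.restrict_apply measurableSet_Ioc.compl] at h1
  have h2 : (Set.Ioc (0 : ℝ) 1)ᶜ ∩ Set.Icc 0 1 ⊆ {0} := by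
    rintro x ⟨hx, hx0, hx1⟩
    by_contra hne
    exact hx ⟨lt_of_le_of_ne hx0 (Ne.symm hne), hx1⟩
  rw [measure_mono_null h2 (by simp)] at h1
  exact h1

/-- By Fubini the diagonal is null for a product of atomless laws. Absence of ties is what forces
unit jumps. -/
theorem ae_injective (h : IsUniformPacing P prior N U) [IsFiniteMeasure P] :
    ∀ᵐ ω ∂P, ∀ i j, i ≠ j → U i ω ≠ U j ω := by
  simp only [ae_all_iff]
  intro i j hij
  have h1 := (h.indep_U.indepFun hij).map_prod_eq_prod_map_map (h.measurable_U i).aemeasurable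
    (h.measurable_U j).aemeasurable
  have hd : MeasurableSet {x : ℝ × ℝ | x.1 = x.2} :=
    measurableSet_eq_fun measurable_fst measurable_snd
  have h2 : P.map (fun ω => (U i ω, U j ω)) {x : ℝ × ℝ | x.1 = x.2} = 0 := by
    rw [h1, Measure.measure_prod_null hd]
    refine Eventually.of_forall fun x => ?_
    have h3 : Prod.mk x ⁻¹' {x : ℝ × ℝ | x.1 = x.2} = {x} := by
      ext y
      simp [eq_comm]
    simp only [h3, Pi.zero_apply]
    rw [Measure.map_apply (h.measurable_U j) (measurableSet_singleton x),
      h.measure_preimage j (measurableSet_singleton x)]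
    simp
  rw [Measure.map_apply ((h.measurable_U i).prodMk (h.measurable_U j)) hd] at h2
  rw [ae_iff]
  simpa using h2

/-- The number of summands is random, so measurability is proved on `ℕ × Ω`, one value of the
countable coordinate at a time, and then pulled back. -/
theorem measurable_process (h : IsUniformPacing P prior N U) (t : unitInterval) :
    Measurable (mixedBinomialProcess N U t) := by
  have h1 : Measurable fun x : ℕ × Ω =>
      ∑ n ∈ Finset.range x.1, (if U n x.2 ≤ (t : ℝ) then 1 else 0 : ℕ) := by
    refine measurable_from_prod_countable_right fun k => ?_
    change Measurable fun ω : Ω => ∑ n ∈ Finset.range k, (if U n ω ≤ (t : ℝ) then 1 else 0 : ℕ)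
    refine Finset.measurable_sum _ fun n _ => ?_
    exact Measurable.ite (measurableSet_le (h.measurable_U n) measurable_const)
      measurable_const measurable_const
  have h2 : mixedBinomialProcess N U t = (fun x : ℕ × Ω =>
      ∑ n ∈ Finset.range x.1, (if U n x.2 ≤ (t : ℝ) then 1 else 0 : ℕ)) ∘ fun ω => (N ω, ω) := by
    ext ω
    simp only [mixedBinomialProcess, Finset.card_filter, Function.comp]
  rw [h2]
  exact h1.comp (h.measurable_N.prodMk measurable_id)

theorem ae_process_zero (h : IsUniformPacing P prior N U) :
    ∀ᵐ ω ∂P, mixedBinomialProcess N U 0 ω = 0 := by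
  filter_upwards [h.ae_mem_Ioc] with ω hω
  simp only [mixedBinomialProcess, Finset.card_eq_zero, Finset.filter_eq_empty_iff]
  intro n _ hn
  exact absurd (hω n).1 (by simpa using hn)

theorem ae_process_one (h : IsUniformPacing P prior N U) :
    ∀ᵐ ω ∂P, mixedBinomialProcess N U 1 ω = N ω := by
  filter_upwards [h.ae_mem_Ioc] with ω hω
  rw [mixedBinomialProcess, Finset.filter_true_of_mem, Finset.card_range]
  intro n _
  simpa using (hω n).2

theorem isSimpleCounting (h : IsUniformPacing P prior N U) [IsFiniteMeasure P] :
    IsSimpleCountingProcess (mixedBinomialProcess N U) P where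
  measurable := h.measurable_process
  start := h.ae_process_zero
  mono := Eventually.of_forall fun ω => monotone_mixedBinomialProcess N U ω
  rightCont := Eventually.of_forall fun ω t => by
    -- Only finitely many points matter, so for `s` close enough to `t` on the right none of them
    -- lies in `(t, s]`.
    have h1 : ∀ᶠ s : unitInterval in 𝓝[≥] t, ∀ n ∈ Finset.range (N ω),
        (U n ω ≤ (s : ℝ) ↔ U n ω ≤ (t : ℝ)) := by
      rw [eventually_all_finset]
      intro n _
      rcases le_or_gt (U n ω) t with hn | hn
      · filter_upwards [self_mem_nhdsWithin] with s hs
        have hs' : (t : ℝ) ≤ s := hs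
        exact ⟨fun _ => hn, fun h => h.trans hs'⟩
      · have h2 : ∀ᶠ s : unitInterval in 𝓝 t, (s : ℝ) < U n ω :=
          continuous_subtype_val.continuousAt.eventually (eventually_lt_nhds hn)
        filter_upwards [h2.filter_mono nhdsWithin_le_nhds] with s hs
        exact ⟨fun h => absurd hs h.not_gt, fun h => absurd hn h.not_gt⟩
    refine ContinuousWithinAt.congr_of_eventuallyEq
      (continuousWithinAt_const (b := mixedBinomialProcess N U t ω)) ?_ rfl
    filter_upwards [h1] with s hs
    simp only [mixedBinomialProcess]
    rw [Finset.filter_congr hs]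
  unitJumps := by
    filter_upwards [h.ae_injective] with ω hω t ht
    have hne : (𝓝[<] t).NeBot := nhdsLT_neBot_of_exists_lt ⟨0, ht⟩
    -- Take `s` beyond all of the finitely many points preceding `t`. Any point in `(s, t]` then
    -- equals `t`, and there is at most one such point.
    have h1 : ∀ᶠ s : unitInterval in 𝓝[<] t, ∀ n ∈ Finset.range (N ω),
        (U n ω < (t : ℝ) → U n ω ≤ (s : ℝ)) := by
      rw [eventually_all_finset]
      intro n _
      by_cases hn : U n ω < t
      · have h2 : ∀ᶠ s : unitInterval in 𝓝 t, U n ω < (s : ℝ) :=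
          continuous_subtype_val.continuousAt.eventually (eventually_gt_nhds hn)
        filter_upwards [h2.filter_mono nhdsWithin_le_nhds] with s hs
        exact fun _ => hs.le
      · exact Eventually.of_forall fun s h => absurd h hn
    obtain ⟨s, hs, hst⟩ := (h1.and self_mem_nhdsWithin).exists
    have hst' : s < t := hst
    refine ⟨s, hst', ?_⟩
    rw [mixedBinomialProcess_eq_add N U hst'.le]
    gcongr
    rw [Finset.card_le_one]
    intro i hi j hj
    simp only [Finset.mem_filter] at hi hj
    have heq : ∀ n, n ∈ Finset.range (N ω) → (s : ℝ) < U n ω → U n ω ≤ t → U n ω = t :=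
      fun n hn h1 h2 => by
        by_contra hlt
        exact absurd (hs n hn (lt_of_le_of_ne h2 hlt)) h1.not_ge
    by_contra hij
    exact hω i j hij ((heq i hi.1 hi.2.1 hi.2.2).trans (heq j hj.1 hj.2.1 hj.2.2).symm)

/-- If the number of points is mixed Poisson, the increments of the process are mixed Poisson. -/
theorem measure_increments (h : IsUniformPacing P prior N U) {G : Measure ℝ}
    (hG : ∀ n, prior {n} = ∫⁻ r, poissonMeasure r.toNNReal {n} ∂G) {m : ℕ}
    {τ : Fin (m + 1) → unitInterval} (hτ : Monotone τ) (k : Fin m → ℕ) :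
    P {ω | ∀ i, mixedBinomialProcess N U (τ i.succ) ω =
        mixedBinomialProcess N U (τ i.castSucc) ω + k i} =
      ∫⁻ r, ∏ i, poissonMeasure
        (r * ((τ i.succ : ℝ) - (τ i.castSucc : ℝ))).toNNReal {k i} ∂G := by
  let _ : MeasurableSpace (Option (Fin m)) := ⊤
  have hcell : Measurable (cellIndex τ) :=
    measurable_to_countable' (measurableSet_cellIndex_preimage hτ)
  let μ : Measure ℝ := volume.restrict (Set.Icc (0 : ℝ) 1)
  have hμ : IsProbabilityMeasure μ := ⟨by simp [μ]⟩
  -- The letter of a point is its cell: `some i` has probability the length of cell `i`, and `none`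
  -- has the remaining mass.
  let p : Option (Fin m) → NNReal := fun i => (μ (cellIndex τ ⁻¹' {i})).toNNReal
  have hp : ∀ n i, P {ω | cellIndex τ (U n ω) = i} = p i := fun n i => by
    rw [ENNReal.coe_toNNReal (measure_ne_top _ _)]
    exact h.measure_preimage n (measurableSet_cellIndex_preimage hτ i)
  have hp1 : ∑ i, p i = 1 := by
    rw [← ENNReal.coe_inj, ENNReal.ofNNReal_finsetSum]
    simp only [p, ENNReal.coe_toNNReal (measure_ne_top _ _)]
    rw [sum_measure_preimage_singleton _ fun i _ => measurableSet_cellIndex_preimage hτ i]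
    simp
  have hps : ∀ i, p (some i) = ((τ i.succ : ℝ) - (τ i.castSucc : ℝ)).toNNReal := fun i => by
    have h1 : cellIndex τ ⁻¹' {some i} = Set.Ioc (τ i.castSucc : ℝ) (τ i.succ) := by
      ext x
      exact cellIndex_eq_some hτ
    have h2 : Set.Ioc (τ i.castSucc : ℝ) (τ i.succ) ⊆ Set.Icc 0 1 := fun x hx =>
      ⟨(τ i.castSucc).2.1.trans hx.1.le, hx.2.trans (τ i.succ).2.2⟩
    simp only [p, μ, h1]
    rw [Measure.restrict_eq_self _ h2, Real.volume_Ioc]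
    rfl
  have hcells : Measurable fun (x : ℕ → ℝ) n => cellIndex τ (x n) :=
    measurable_pi_iff.2 fun n => hcell.comp (measurable_pi_apply n)
  have key := measure_card_filter_range_eq_lintegral (L := fun n ω => cellIndex τ (U n ω))
    h.measurable_N (fun n => hcell.comp (h.measurable_U n))
    (h.indep_U.comp (fun _ => cellIndex τ) fun _ => hcell)
    (h.indep_N_U.comp (φ := id) (ψ := fun (x : ℕ → ℝ) n => cellIndex τ (x n)) measurable_id
      hcells) hp hp1
    (G := G) (fun n => (h.law_N.measure_eq (measurableSet_singleton n)).trans (hG n)) k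
  convert key using 3
  · ext ω
    refine forall_congr' fun i => ?_
    rw [mixedBinomialProcess_eq_add N U (hτ (Fin.castSucc_le_succ i))]
    simp only [cellIndex_eq_some hτ, add_right_inj]
  · refine Finset.prod_congr rfl fun i _ => ?_
    have h1 : (0 : ℝ) ≤ (τ i.succ : ℝ) - (τ i.castSucc : ℝ) :=
      sub_nonneg.2 (hτ (Fin.castSucc_le_succ i))
    rw [hps, mul_comm, Real.toNNReal_mul h1, mul_comm]

end IsUniformPacing

/-! ### Transition probabilities and the Markov property. -/

/-- Telescoping without subtraction, so that it serves both real times and natural-number states. -/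
theorem Fin.last_eq_add_sum {M : Type*} [AddCommMonoid M] {m : ℕ} {f : Fin (m + 1) → M}
    {k : Fin m → M} (h : ∀ i, f i.succ = f i.castSucc + k i) :
    f (Fin.last m) = f 0 + ∑ i, k i := by
  induction m with
  | zero => simp
  | succ m ih =>
    have h1 := ih (f := fun i => f i.castSucc) (k := fun i => k i.castSucc) fun i => h i.castSucc
    rw [Fin.sum_univ_castSucc, ← add_assoc, ← Fin.succ_last, h (Fin.last m), h1]
    simp

theorem negBinomialWeight_nonneg {a q : ℝ} (ha : 0 < a) (hq0 : 0 ≤ q) (hq1 : q ≤ 1) (n : ℕ) :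
    0 ≤ negBinomialWeight a q n := by
  have h1 := ascPochhammer_pos n a ha
  have h2 : 0 ≤ 1 - q := sub_nonneg.2 hq1
  unfold negBinomialWeight
  positivity

/-- The probability of passing from state `k` at time `s` to state `j` at time `t`, for a Poisson
process mixed over a `Gamma(a, b)`-distributed rate. -/
noncomputable def polyaTransition (a b : ℝ) (s t : unitInterval) (k j : ℕ) : ℝ :=
  if k ≤ j then negBinomialWeight (a + k) (((t : ℝ) - s) / (b + t)) (j - k) else 0

theorem polyaTransition_nonneg {a b : ℝ} (ha : 0 < a) (hb : 0 < b) {s t : unitInterval}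
    (hst : s ≤ t) (k j : ℕ) : 0 ≤ polyaTransition a b s t k j := by
  have hst' : (s : ℝ) ≤ t := hst
  have hs := s.2.1
  have hbt : 0 < b + (t : ℝ) := by linarith
  unfold polyaTransition
  split_ifs
  · refine negBinomialWeight_nonneg (by positivity) (div_nonneg (by linarith) hbt.le) ?_ _
    rw [div_le_one hbt]
    linarith
  · exact le_rfl

namespace IsMixedPoissonProcess

variable {Ω : Type*} [MeasurableSpace Ω] {P : Measure Ω} {X : unitInterval → Ω → ℕ} {a b : ℝ}

/-- Since the grid starts at `0`, the lengths telescope to the last time, and the Gamma factor sees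
only that time and the final count. -/
theorem measure_increments_eq (h : IsMixedPoissonProcess X (gammaMeasure a b) P) (ha : 0 < a)
    (hb : 0 < b) {m : ℕ} {τ : Fin (m + 1) → unitInterval} (hτ : Monotone τ) (hτ0 : τ 0 = 0)
    (k : Fin m → ℕ) :
    P {ω | ∀ i, X (τ i.succ) ω = X (τ i.castSucc) ω + k i} =
      ENNReal.ofReal (gammaMoment a b (τ (Fin.last m)) (∑ i, k i) *
        ∏ i, ((τ i.succ : ℝ) - τ i.castSucc) ^ k i / (k i).factorial) := by
  have h1 := Fin.last_eq_add_sum (f := fun i => (τ i : ℝ))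
    (k := fun i => (τ i.succ : ℝ) - τ i.castSucc) fun i => by ring
  rw [hτ0, Set.Icc.coe_zero, zero_add] at h1
  rw [h.increments m τ hτ k, lintegral_prod_poissonMeasure_gammaMeasure ha hb
    (fun i => sub_nonneg.2 (hτ (Fin.castSucc_le_succ i))) k, h1]

theorem measure_increments_inter (h : IsMixedPoissonProcess X (gammaMeasure a b) P) (ha : 0 < a)
    (hb : 0 < b) {m : ℕ} {τ : Fin (m + 1) → unitInterval} (hτ : Monotone τ) (hτ0 : τ 0 = 0)
    {t : unitInterval} (ht : τ (Fin.last m) ≤ t) (k : Fin m → ℕ) (d : ℕ) :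
    P ({ω | ∀ i, X (τ i.succ) ω = X (τ i.castSucc) ω + k i} ∩
        {ω | X t ω = X (τ (Fin.last m)) ω + d}) =
      P {ω | ∀ i, X (τ i.succ) ω = X (τ i.castSucc) ω + k i} *
        ENNReal.ofReal (negBinomialWeight (a + (∑ i, k i : ℕ))
          (((t : ℝ) - τ (Fin.last m)) / (b + t)) d) := by
  -- Appending `t` to the grid turns the intersection into a single increment event; its probability
  -- and that of the shorter grid differ by the ratio in `gammaMoment_add`.
  let σ : Fin (m + 1 + 1) → unitInterval := Fin.snoc (α := fun _ => unitInterval) τ t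
  have hσ : Monotone σ := by
    refine Fin.monotone_iff_le_succ.2 fun i => ?_
    refine Fin.lastCases ?_ (fun i => ?_) i
    · simpa [σ, Fin.succ_last] using ht
    · simpa [σ, ← Fin.castSucc_succ] using hτ (Fin.castSucc_le_succ i)
  have hσ0 : σ 0 = 0 := by
    rw [← hτ0]
    exact Fin.snoc_castSucc (α := fun _ => unitInterval) t τ 0
  have h1 := h.measure_increments_eq ha hb hσ hσ0 (Fin.snoc (α := fun _ => ℕ) k d)
  have hset : {ω | ∀ i, X (σ i.succ) ω =
      X (σ i.castSucc) ω + (Fin.snoc k d : Fin (m + 1) → ℕ) i} =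
      {ω | ∀ i, X (τ i.succ) ω = X (τ i.castSucc) ω + k i} ∩
        {ω | X t ω = X (τ (Fin.last m)) ω + d} := by
    ext ω
    simp only [Set.mem_ofPred_eq, Set.mem_inter_iff, Fin.forall_fin_succ', σ, Fin.succ_last,
      ← Fin.castSucc_succ, Fin.snoc_last, Fin.snoc_castSucc]
  rw [hset] at h1
  have h0 := (τ (Fin.last m)).2.1
  have hd : (0 : ℝ) ≤ (t : ℝ) - τ (Fin.last m) := sub_nonneg.2 ht
  have hprod : 0 ≤ ∏ i, ((τ i.succ : ℝ) - τ i.castSucc) ^ k i / (k i).factorial :=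
    Finset.prod_nonneg fun i _ => by
      have h1 : (0 : ℝ) ≤ (τ i.succ : ℝ) - τ i.castSucc :=
        sub_nonneg.2 (hτ (Fin.castSucc_le_succ i))
      positivity
  have h2 := gammaMoment_add ha hb h0 hd (∑ i, k i) d
  have h3 : (τ (Fin.last m) : ℝ) + ((t : ℝ) - τ (Fin.last m)) = t := by ring
  rw [add_assoc b, h3] at h2
  rw [h1, h.measure_increments_eq ha hb hτ hτ0, ← ENNReal.ofReal_mul
    (mul_nonneg (gammaMoment_pos ha hb h0 _).le hprod), Fin.sum_univ_castSucc,
    Fin.prod_univ_castSucc]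
  simp only [σ, Fin.succ_last, ← Fin.castSucc_succ, Fin.snoc_last, Fin.snoc_castSucc]
  congr 1
  linear_combination (∏ i, ((τ i.succ : ℝ) - τ i.castSucc) ^ k i / (k i).factorial) * h2

/-- The Markov property along a finite grid. -/
theorem measure_path_inter (h : IsMixedPoissonProcess X (gammaMeasure a b) P) (ha : 0 < a)
    (hb : 0 < b) {m : ℕ} {τ : Fin (m + 1) → unitInterval} (hτ : Monotone τ) (hτ0 : τ 0 = 0)
    {t : unitInterval} (ht : τ (Fin.last m) ≤ t) (v : Fin (m + 1) → ℕ) (j : ℕ) :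
    P ({ω | ∀ i, X (τ i) ω = v i} ∩ {ω | X t ω = j}) =
      P {ω | ∀ i, X (τ i) ω = v i} *
        ENNReal.ofReal (polyaTransition a b (τ (Fin.last m)) t (v (Fin.last m)) j) := by
  have hnull : ∀ {A : Set Ω}, (∀ᵐ ω ∂P, ω ∉ A) → P A = 0 := fun {A} hA =>
    measure_eq_zero_iff_ae_notMem.2 hA
  -- A value sequence that decreases somewhere or does not start at `0` has probability zero, so
  -- both sides vanish. Otherwise values and increments determine each other almost surely.
  by_cases hv : Monotone v ∧ v 0 = 0
  · obtain ⟨hv, hv0⟩ := hv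
    let k : Fin m → ℕ := fun i => v i.succ - v i.castSucc
    have hk : ∀ i, v i.succ = v i.castSucc + k i := fun i =>
      (Nat.add_sub_cancel' (hv (Fin.castSucc_le_succ i))).symm
    have hpath : ∀ᵐ ω ∂P, (∀ i, X (τ i) ω = v i) ↔
        ∀ i, X (τ i.succ) ω = X (τ i.castSucc) ω + k i := by
      filter_upwards [h.counting.start] with ω hω
      refine ⟨fun hi i => by rw [hi, hi, hk], fun hi i => ?_⟩
      induction i using Fin.induction with
      | zero => rw [hτ0, hω, hv0]
      | succ i ih => rw [hi, ih, hk]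
    have hA : ({ω | ∀ i, X (τ i) ω = v i} : Set Ω) =ᵐ[P]
        {ω | ∀ i, X (τ i.succ) ω = X (τ i.castSucc) ω + k i} := by
      filter_upwards [hpath] with ω hω
      exact propext hω
    have hsum : v (Fin.last m) = ∑ i, k i := by
      rw [Fin.last_eq_add_sum hk, hv0, zero_add]
    by_cases hj : v (Fin.last m) ≤ j
    · have hAB : ({ω | ∀ i, X (τ i) ω = v i} ∩ {ω | X t ω = j} : Set Ω) =ᵐ[P]
          ({ω | ∀ i, X (τ i.succ) ω = X (τ i.castSucc) ω + k i} ∩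
            {ω | X t ω = X (τ (Fin.last m)) ω + (j - v (Fin.last m))} : Set Ω) := by
        filter_upwards [hpath] with ω hω
        refine propext ⟨fun ⟨h1, h2⟩ => ⟨hω.1 h1, ?_⟩, fun ⟨h1, h2⟩ => ⟨hω.2 h1, ?_⟩⟩
        · have h2' : X t ω = j := h2
          change X t ω = _
          rw [h1 (Fin.last m)]
          omega
        · have h2' : X t ω = X (τ (Fin.last m)) ω + (j - v (Fin.last m)) := h2
          change X t ω = j
          rw [hω.2 h1 (Fin.last m)] at h2'
          omega
      rw [measure_congr hA, measure_congr hAB, h.measure_increments_inter ha hb hτ hτ0 ht,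
        polyaTransition, if_pos hj, ← hsum]
    · rw [polyaTransition, if_neg hj, ENNReal.ofReal_zero, mul_zero]
      refine hnull ?_
      filter_upwards [h.counting.mono] with ω hω hmem
      have h1 : X (τ (Fin.last m)) ω = v (Fin.last m) := hmem.1 _
      have h2 : X t ω = j := hmem.2
      have h3 : X (τ (Fin.last m)) ω ≤ X t ω := hω ht
      omega
  · have h0 : P {ω | ∀ i, X (τ i) ω = v i} = 0 := by
      refine hnull ?_
      filter_upwards [h.counting.mono, h.counting.start] with ω hω hω0 hmem
      have hmem' : ∀ i, X (τ i) ω = v i := hmem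
      refine hv ⟨fun i i' hii' => ?_, ?_⟩
      · rw [← hmem', ← hmem']
        exact hω (hτ hii')
      · rw [← hmem', hτ0, hω0]
    rw [h0, zero_mul]
    exact measure_mono_null Set.inter_subset_left h0

theorem pastSigma_le (h : IsMixedPoissonProcess X (gammaMeasure a b) P) (s : unitInterval) :
    pastSigma X s ≤ ‹MeasurableSpace Ω› :=
  iSup_le fun r => (h.counting.measurable r).comap_le

/-- The Markov property in integrated form: the transition probabilities disintegrate the law of
the process at time `t` over the events up to time `s`. -/
theorem measure_inter_eq_setLIntegral (h : IsMixedPoissonProcess X (gammaMeasure a b) P)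
    [IsFiniteMeasure P] (ha : 0 < a) (hb : 0 < b) {s t : unitInterval} (hst : s ≤ t) (j : ℕ)
    {A : Set Ω} (hA : MeasurableSet[pastSigma X s] A) :
    P (A ∩ {ω | X t ω = j}) =
      ∫⁻ ω in A, ENNReal.ofReal (polyaTransition a b s t (X s ω) j) ∂P := by
  classical
  let g : Ω → ENNReal := fun ω => ENNReal.ofReal (polyaTransition a b s t (X s ω) j)
  let B : Set Ω := {ω | X t ω = j}
  have hB : MeasurableSet B := h.counting.measurable t (measurableSet_singleton j)
  -- Finite intersections of single-time events form a π-system generating the past. The finite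
  -- measures `P.restrict B` and `P.withDensity g` are compared on it.
  let C : Set (Set Ω) := piiUnionInter
    (fun r : Set.Iic s => {A | MeasurableSet[MeasurableSpace.comap (X r) ⊤] A}) Set.univ
  have hgen : pastSigma X s = MeasurableSpace.generateFrom C := by
    have h1 := generateFrom_piiUnionInter_measurableSet
      (fun r : Set.Iic s => MeasurableSpace.comap (X r) ⊤) Set.univ
    simp only [Set.mem_univ, iSup_pos] at h1
    exact h1.symm
  have hC : ∀ A ∈ C, P.restrict B A = P.withDensity g A := by
    rintro A ⟨S, -, f, hf, rfl⟩
    choose! D hD using hf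
    -- Adding `0` and `s` makes the grid start at `0` and end at `s`, so that `measure_path_inter`
    -- applies and the last coordinate is the state on which `g` depends.
    let S' : Finset unitInterval := insert 0 (insert s (S.image Subtype.val))
    obtain ⟨m, hm⟩ : ∃ m, S'.card = m + 1 :=
      Nat.exists_eq_succ_of_ne_zero (Finset.card_ne_zero_of_mem (Finset.mem_insert_self _ _))
    let τ : Fin (m + 1) → unitInterval := S'.orderEmbOfFin hm
    have hτ : Monotone τ := (S'.orderEmbOfFin hm).monotone
    have hmem : ∀ r ∈ S', ∃ i, τ i = r := fun r hr => by
      have : r ∈ Set.range (S'.orderEmbOfFin hm) := by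
        rw [Finset.range_orderEmbOfFin]
        exact hr
      exact this
    have hτ0 : τ 0 = 0 := by
      obtain ⟨i, hi⟩ := hmem 0 (by simp [S'])
      exact le_antisymm (hi ▸ hτ (Fin.zero_le i)) unitInterval.nonneg'
    have hτs : τ (Fin.last m) = s := by
      obtain ⟨i, hi⟩ := hmem s (by simp [S'])
      refine le_antisymm ?_ (hi ▸ hτ (Fin.le_last i))
      have h1 : τ (Fin.last m) ∈ S' := S'.orderEmbOfFin_mem hm _
      simp only [S', Finset.mem_insert, Finset.mem_image] at h1
      rcases h1 with h1 | h1 | ⟨r, -, h1⟩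
      · rw [h1]
        exact unitInterval.nonneg'
      · exact h1.le
      · exact h1 ▸ r.2
    let Z : Ω → Fin (m + 1) → ℕ := fun ω i => X (τ i) ω
    have hZ : Measurable Z := measurable_pi_lambda _ fun i => h.counting.measurable _
    have hmap : (P.restrict B).map Z = (P.withDensity g).map Z := by
      refine Measure.ext_of_singleton fun v => ?_
      have hv : MeasurableSet (Z ⁻¹' {v}) := hZ (measurableSet_singleton v)
      rw [Measure.map_apply hZ (measurableSet_singleton v),
        Measure.map_apply hZ (measurableSet_singleton v), Measure.restrict_apply hv,
        withDensity_apply _ hv]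
      have h1 : Z ⁻¹' {v} = {ω | ∀ i, X (τ i) ω = v i} := by
        ext ω
        exact funext_iff
      -- On a fibre of `Z` the state at time `s` is fixed, so `g` is constant there.
      have h2 : ∫⁻ ω in Z ⁻¹' {v}, g ω ∂P =
          ∫⁻ ω in Z ⁻¹' {v}, ENNReal.ofReal (polyaTransition a b s t (v (Fin.last m)) j) ∂P := by
        refine setLIntegral_congr_fun hv fun ω hω => ?_
        have h3 : X (τ (Fin.last m)) ω = v (Fin.last m) := congrFun hω (Fin.last m)
        simp only [g, ← h3, hτs]
      rw [h2, setLIntegral_const, h1, h.measure_path_inter ha hb hτ hτ0 (hτs.trans_le hst), hτs,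
        mul_comm]
    have hAZ : ⋂ r ∈ S, f r = Z ⁻¹' {v | ∀ r ∈ S, ∀ i, τ i = r → v i ∈ D r} := by
      ext ω
      simp only [Set.mem_iInter, Set.mem_preimage, Set.mem_ofPred_eq, Z]
      refine forall₂_congr fun r hr => ?_
      rw [← (hD r hr).2]
      constructor
      · rintro hω i hi
        rw [hi]
        exact hω
      · intro hω
        obtain ⟨i, hi⟩ := hmem r
          (Finset.mem_insert_of_mem (Finset.mem_insert_of_mem (Finset.mem_image_of_mem _ hr)))
        have := hω i hi
        rwa [hi] at this
    have hall : ∀ D' : Set (Fin (m + 1) → ℕ), MeasurableSet D' := fun D' =>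
      D'.to_countable.measurableSet
    rw [hAZ, ← Measure.map_apply hZ (hall _), hmap, Measure.map_apply hZ (hall _)]
  -- The empty intersection is the whole space, which gives equality of the total masses.
  have huniv : P.restrict B Set.univ = P.withDensity g Set.univ :=
    hC _ ⟨∅, by simp, fun _ => Set.univ, by simp, by simp⟩
  have key := ext_on_measurableSpace_of_generate_finite _ C hC (h.pastSigma_le s) hgen
    (isPiSystem_piiUnionInter
      (fun r : Set.Iic s => {A | MeasurableSet[MeasurableSpace.comap (X r) ⊤] A})
      (fun r => @MeasurableSpace.isPiSystem_measurableSet _ (MeasurableSpace.comap (X r) ⊤))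
      Set.univ)
    huniv hA
  have hA' := h.pastSigma_le s A hA
  rwa [Measure.restrict_apply hA', withDensity_apply _ hA'] at key

/-- The transition probabilities of the process. -/
theorem cond_apply_eq_polyaTransition (h : IsMixedPoissonProcess X (gammaMeasure a b) P)
    [IsFiniteMeasure P] (ha : 0 < a) (hb : 0 < b) {s t : unitInterval} (hst : s ≤ t) {k : ℕ}
    (hk : P {ω | X s ω = k} ≠ 0) (j : ℕ) :
    cond P {ω | X s ω = k} {ω | X t ω = j} = ENNReal.ofReal (polyaTransition a b s t k j) := by
  have hA : MeasurableSet {ω | X s ω = k} := h.counting.measurable s (measurableSet_singleton k)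
  have hA' : MeasurableSet[pastSigma X s] {ω | X s ω = k} :=
    le_iSup (fun r : Set.Iic s => MeasurableSpace.comap (X r) ⊤) ⟨s, Set.self_mem_Iic⟩ _
      ⟨{k}, trivial, rfl⟩
  have h1 : ∫⁻ ω in {ω | X s ω = k}, ENNReal.ofReal (polyaTransition a b s t (X s ω) j) ∂P =
      ∫⁻ ω in {ω | X s ω = k}, ENNReal.ofReal (polyaTransition a b s t k j) ∂P :=
    setLIntegral_congr_fun hA fun ω hω => by
      have hω' : X s ω = k := hω
      simp only [hω']
  rw [cond_apply hA, h.measure_inter_eq_setLIntegral ha hb hst j hA', h1, setLIntegral_const,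
    mul_left_comm, ENNReal.inv_mul_cancel hk (measure_ne_top _ _), mul_one]

/-- The one-dimensional marginals of the process. -/
theorem measure_eq_negBinomialWeight (h : IsMixedPoissonProcess X (gammaMeasure a b) P)
    (ha : 0 < a) (hb : 0 < b) (t : unitInterval) (k : ℕ) :
    P {ω | X t ω = k} = ENNReal.ofReal (negBinomialWeight a ((t : ℝ) / (b + t)) k) := by
  have hτ : Monotone ![(0 : unitInterval), t] := by
    refine Fin.monotone_iff_le_succ.2 fun i => ?_
    rw [Subsingleton.elim i 0]
    exact unitInterval.nonneg'
  have h1 := h.measure_increments_eq ha hb hτ rfl fun _ => k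
  rw [negBinomialWeight_eq_gammaMoment ha hb t.2.1]
  have h2 : ({ω | X t ω = k} : Set Ω) =ᵐ[P]
      {ω | ∀ i : Fin 1, X (![(0 : unitInterval), t] i.succ) ω =
        X (![(0 : unitInterval), t] i.castSucc) ω + k} := by
    filter_upwards [h.counting.start] with ω hω
    refine propext ?_
    change X t ω = k ↔ ∀ i : Fin 1, X (![(0 : unitInterval), t] i.succ) ω =
        X (![(0 : unitInterval), t] i.castSucc) ω + k
    simp [hω]
  rw [measure_congr h2, h1]
  simp

end IsMixedPoissonProcess

/-- The σ-algebra `m` ranges between that of `X s` and the full past. The two extremes give the same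
conditional probability, which is the Markov property. -/
theorem IsMixedPoissonProcess.condExp_eq_polyaTransition {Ω : Type*} {m mΩ : MeasurableSpace Ω}
    {P : Measure Ω} {X : unitInterval → Ω → ℕ} {a b : ℝ}
    (h : IsMixedPoissonProcess X (gammaMeasure a b) P)
    [IsFiniteMeasure P] (ha : 0 < a) (hb : 0 < b) {s t : unitInterval} (hst : s ≤ t) (j : ℕ)
    (hm : m ≤ pastSigma X s) (hXm : MeasurableSpace.comap (X s) ⊤ ≤ m) :
    (fun ω => polyaTransition a b s t (X s ω) j) =ᵐ[P] P⟦{ω | X t ω = j} | m⟧ := by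
  have hm0 : m ≤ mΩ := hm.trans (h.pastSigma_le s)
  have hB : MeasurableSet {ω | X t ω = j} := h.counting.measurable t (measurableSet_singleton j)
  have hX : Measurable[m] (X s) := Measurable.of_comap_le hXm
  have hgm : Measurable[m] fun ω => polyaTransition a b s t (X s ω) j :=
    (measurable_of_countable fun k => polyaTransition a b s t k j).comp hX
  have hg : Measurable fun ω => polyaTransition a b s t (X s ω) j := hgm.mono hm0 le_rfl
  have hg0 : ∀ ω, 0 ≤ polyaTransition a b s t (X s ω) j := fun ω =>
    polyaTransition_nonneg ha hb hst _ _
  have hint : Integrable (fun ω => polyaTransition a b s t (X s ω) j) P := by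
    refine ⟨hg.aestronglyMeasurable, ?_⟩
    rw [hasFiniteIntegral_iff_ofReal (Eventually.of_forall hg0)]
    have h1 := h.measure_inter_eq_setLIntegral ha hb hst j MeasurableSet.univ
    rw [Measure.restrict_univ] at h1
    rw [← h1]
    exact measure_lt_top _ _
  refine ae_eq_condExp_of_forall_setIntegral_eq hm0 ((integrable_const 1).indicator hB)
    (fun _ _ _ => hint.integrableOn) (fun A hA _ => ?_) hgm.stronglyMeasurable.aestronglyMeasurable
  rw [integral_eq_lintegral_of_nonneg_ae (Eventually.of_forall hg0) hg.aestronglyMeasurable,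
    ← h.measure_inter_eq_setLIntegral ha hb hst j (hm A hA), integral_indicator_const _ hB,
    measureReal_def, Measure.restrict_apply hB, Set.inter_comm, smul_eq_mul, mul_one]

/-! ### Infinitesimal transition probabilities. -/

theorem polyaTransition_self (a b : ℝ) (s t : unitInterval) (k : ℕ) :
    polyaTransition a b s t k k = (1 - ((t : ℝ) - s) / (b + t)) ^ (a + k) := by
  simp [polyaTransition, negBinomialWeight]

theorem polyaTransition_succ (a b : ℝ) (s t : unitInterval) (k : ℕ) :
    polyaTransition a b s t k (k + 1) =
      (a + k) * (1 - ((t : ℝ) - s) / (b + t)) ^ (a + k) * (((t : ℝ) - s) / (b + t)) := by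
  simp [polyaTransition, negBinomialWeight]

/-- The probability of a jump between the two times tends to `0` as they come together. -/
theorem tendsto_sub_div_add {b : ℝ} (hb : 0 < b) (t : unitInterval) :
    Tendsto (fun p : unitInterval × unitInterval => ((p.2 : ℝ) - p.1) / (b + p.2))
      (𝓝 (t, t)) (𝓝 0) := by
  have ht : b + (t : ℝ) ≠ 0 := by
    have := t.2.1
    positivity
  have h : ContinuousAt (fun p : unitInterval × unitInterval => ((p.2 : ℝ) - p.1) / (b + p.2))
      (t, t) := by
    refine ContinuousAt.div ?_ ?_ ht <;> fun_prop
  simpa [ContinuousAt] using h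

theorem tendsto_inv_add {b : ℝ} (hb : 0 < b) (t : unitInterval) :
    Tendsto (fun p : unitInterval × unitInterval => (b + (p.2 : ℝ))⁻¹)
      (𝓝 (t, t)) (𝓝 (b + (t : ℝ))⁻¹) := by
  have ht : b + (t : ℝ) ≠ 0 := by
    have := t.2.1
    positivity
  have h : ContinuousAt (fun p : unitInterval × unitInterval => (b + (p.2 : ℝ))⁻¹) (t, t) := by
    refine ContinuousAt.inv₀ ?_ ht
    fun_prop
  exact h

theorem tendsto_one_sub_rpow {b : ℝ} (hb : 0 < b) (t : unitInterval) (c : ℝ) :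
    Tendsto (fun p : unitInterval × unitInterval => (1 - ((p.2 : ℝ) - p.1) / (b + p.2)) ^ c)
      (𝓝 (t, t)) (𝓝 1) := by
  have h := ((tendsto_sub_div_add hb t).const_sub 1).rpow_const (p := c) (by simp)
  simpa using h

/-- Division by the time step turns the last factor of `polyaTransition_succ` into the inverse of `b
+ p.2`, while the power tends to `1`. -/
theorem tendsto_polyaTransition_succ_div {a b : ℝ} (hb : 0 < b) (t : unitInterval) (k : ℕ) :
    Tendsto (fun p : unitInterval × unitInterval =>
        polyaTransition a b p.1 p.2 k (k + 1) / ((p.2 : ℝ) - p.1))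
      (𝓝[{p | p.1 < p.2}] (t, t)) (𝓝 ((a + k) / (b + t))) := by
  have h := (((tendsto_one_sub_rpow hb t (a + k)).const_mul (a + k)).mul
    (tendsto_inv_add hb t)).mono_left (nhdsWithin_le_nhds (s := {p | p.1 < p.2}))
  rw [mul_one, ← div_eq_mul_inv] at h
  refine h.congr' ?_
  filter_upwards [self_mem_nhdsWithin] with p hp
  have hp' : (p.1 : ℝ) < p.2 := hp
  have h1 : (p.2 : ℝ) - p.1 ≠ 0 := (sub_pos.2 hp').ne'
  have h2 : b + (p.2 : ℝ) ≠ 0 := by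
    have := p.2.2.1
    positivity
  rw [polyaTransition_succ, eq_div_iff h1]
  ring

/-- With `y = 1 - (p.2 - p.1) / (b + p.2)`, the probability of leaving `k` is `1 - y ^ (a + k)`.
Divided by the time step it is a slope of the power function at `1` times the inverse of `b + p.2`,
so it has the same limit as the one-jump quotient, and the difference vanishes. -/
theorem tendsto_polyaTransition_more_div {a b : ℝ} (hb : 0 < b) (t : unitInterval) (k : ℕ) :
    Tendsto (fun p : unitInterval × unitInterval =>
        (1 - polyaTransition a b p.1 p.2 k k - polyaTransition a b p.1 p.2 k (k + 1)) /
          ((p.2 : ℝ) - p.1))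
      (𝓝[{p | p.1 < p.2}] (t, t)) (𝓝 0) := by
  have hpos : ∀ p : unitInterval × unitInterval, 0 < b + (p.2 : ℝ) := fun p => by
    have := p.2.2.1
    positivity
  have hy : Tendsto (fun p : unitInterval × unitInterval => 1 - ((p.2 : ℝ) - p.1) / (b + p.2))
      (𝓝[{p | p.1 < p.2}] (t, t)) (𝓝[≠] 1) := by
    refine tendsto_nhdsWithin_iff.2 ⟨?_, ?_⟩
    · simpa using ((tendsto_sub_div_add hb t).const_sub 1).mono_left nhdsWithin_le_nhds
    · filter_upwards [self_mem_nhdsWithin] with p hp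
      have hp' : (p.1 : ℝ) < p.2 := hp
      have h1 := div_pos (sub_pos.2 hp') (hpos p)
      exact ne_of_lt (by linarith)
  have hslope : Tendsto (slope (fun y : ℝ => y ^ (a + k)) 1) (𝓝[≠] 1) (𝓝 (a + k)) := by
    have := (Real.hasDerivAt_rpow_const (x := 1) (p := a + k) (Or.inl one_ne_zero))
    rw [hasDerivAt_iff_tendsto_slope] at this
    simpa using this
  have h1 := tendsto_polyaTransition_succ_div (a := a) hb t k
  have h2 := ((hslope.comp hy).mul ((tendsto_inv_add hb t).mono_left nhdsWithin_le_nhds)).sub h1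
  rw [← div_eq_mul_inv, sub_self] at h2
  refine h2.congr' ?_
  filter_upwards [self_mem_nhdsWithin] with p hp
  have hp' : (p.1 : ℝ) < p.2 := hp
  have h3 : (p.2 : ℝ) - p.1 ≠ 0 := (sub_pos.2 hp').ne'
  have h4 := (hpos p).ne'
  rw [Function.comp, slope_def_field, polyaTransition_self, Real.one_rpow]
  have h5 : 1 - ((p.2 : ℝ) - p.1) / (b + p.2) - 1 = -(((p.2 : ℝ) - p.1) / (b + p.2)) := by ring
  rw [h5]
  field_simp
  ring

/-! ### The birth process and its laws. -/

namespace IsMixedPoissonProcess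

variable {Ω : Type*} [MeasurableSpace Ω] {P : Measure Ω} {X : unitInterval → Ω → ℕ} {a b : ℝ}

/-- Paths are almost surely monotone, so given state `k` at time `s` the only later values below `k
+ 2` are `k` and `k + 1`. -/
theorem cond_real_more_eq (h : IsMixedPoissonProcess X (gammaMeasure a b) P)
    [IsFiniteMeasure P] (ha : 0 < a) (hb : 0 < b) {s t : unitInterval} (hst : s ≤ t) {k : ℕ}
    (hk : P {ω | X s ω = k} ≠ 0) :
    (cond P {ω | X s ω = k}).real {ω | k + 2 ≤ X t ω} =
      1 - polyaTransition a b s t k k - polyaTransition a b s t k (k + 1) := by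
  have hQ : IsProbabilityMeasure (cond P {ω | X s ω = k}) := cond_isProbabilityMeasure hk
  have hA : MeasurableSet {ω | X s ω = k} := h.counting.measurable s (measurableSet_singleton k)
  have hms : ∀ j, MeasurableSet {ω | X t ω = j} := fun j =>
    h.counting.measurable t (measurableSet_singleton j)
  have hreal : ∀ j, (cond P {ω | X s ω = k}).real {ω | X t ω = j} =
      polyaTransition a b s t k j := fun j => by
    rw [measureReal_def, h.cond_apply_eq_polyaTransition ha hb hst hk,
      ENNReal.toReal_ofReal (polyaTransition_nonneg ha hb hst _ _)]
  have hae : ({ω | k + 2 ≤ X t ω} : Set Ω) =ᵐ[cond P {ω | X s ω = k}]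
      (({ω | X t ω = k} ∪ {ω | X t ω = k + 1})ᶜ : Set Ω) := by
    filter_upwards [ae_cond_of_forall_mem hA (p := fun ω => X s ω = k) fun ω hω => hω,
      cond_absolutelyContinuous.ae_le h.counting.mono] with ω h1 h2
    have h3 : X s ω ≤ X t ω := h2 hst
    refine propext ?_
    change k + 2 ≤ X t ω ↔ ¬ (X t ω = k ∨ X t ω = k + 1)
    omega
  have hdisj : Disjoint {ω | X t ω = k} {ω | X t ω = k + 1} :=
    Set.disjoint_left.2 fun ω h1 h2 => by
      have h1' : X t ω = k := h1
      have h2' : X t ω = k + 1 := h2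
      omega
  rw [measureReal_congr hae, probReal_compl_eq_one_sub ((hms _).union (hms _)),
    measureReal_union hdisj (hms _), hreal, hreal]
  ring

theorem isBirth (h : IsMixedPoissonProcess X (gammaMeasure a b) P) [IsFiniteMeasure P]
    (ha : 0 < a) (hb : 0 < b) : IsBirthProcess X (fun t k => ((k : ℝ) + a) / (t + b)) P where
  counting := h.counting
  markov s t hst j := by
    have hs : MeasurableSpace.comap (X s) ⊤ ≤ pastSigma X s :=
      le_iSup (fun r : Set.Iic s => MeasurableSpace.comap (X r) ⊤) ⟨s, Set.self_mem_Iic⟩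
    exact (h.condExp_eq_polyaTransition ha hb hst j le_rfl hs).symm.trans
      (h.condExp_eq_polyaTransition ha hb hst j hs le_rfl)
  rate_one t k := by
    have hsub : timesAround X P k t ⊆ {p | p.1 < p.2} := fun p hp => hp.2.2.1
    have h1 := (tendsto_polyaTransition_succ_div (a := a) hb t k).mono_left
      (nhdsWithin_mono _ hsub)
    rw [add_comm a, add_comm b] at h1
    refine h1.congr' ?_
    filter_upwards [self_mem_nhdsWithin] with p hp
    rw [measureReal_def, h.cond_apply_eq_polyaTransition ha hb hp.2.2.1.le hp.2.2.2,
      ENNReal.toReal_ofReal (polyaTransition_nonneg ha hb hp.2.2.1.le _ _)]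
  rate_more t k := by
    have hsub : timesAround X P k t ⊆ {p | p.1 < p.2} := fun p hp => hp.2.2.1
    refine ((tendsto_polyaTransition_more_div (a := a) hb t k).mono_left
      (nhdsWithin_mono _ hsub)).congr' ?_
    filter_upwards [self_mem_nhdsWithin] with p hp
    rw [h.cond_real_more_eq ha hb hp.2.2.1.le hp.2.2.2]

theorem hasLaw_negBinomialMeasure (h : IsMixedPoissonProcess X (gammaMeasure a b) P)
    (ha : 0 < a) (hb : 0 < b) (t : unitInterval) :
    HasLaw (X t) (negBinomialMeasure a ((t : ℝ) / (b + t))) P where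
  aemeasurable := (h.counting.measurable t).aemeasurable
  map_eq := by
    refine Measure.ext_of_singleton fun k => ?_
    rw [Measure.map_apply (h.counting.measurable t) (measurableSet_singleton k),
      negBinomialMeasure_singleton, ← h.measure_eq_negBinomialWeight ha hb]
    rfl

theorem hasLaw_sub_cond (h : IsMixedPoissonProcess X (gammaMeasure a b) P) [IsFiniteMeasure P]
    (ha : 0 < a) (hb : 0 < b) {s t : unitInterval} (hst : s ≤ t) {k : ℕ}
    (hk : P {ω | X s ω = k} ≠ 0) :
    HasLaw (fun ω => X t ω - X s ω) (negBinomialMeasure (a + k) (((t : ℝ) - s) / (b + t)))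
      (cond P {ω | X s ω = k}) := by
  have hmeas : Measurable fun ω => X t ω - X s ω :=
    (h.counting.measurable t).sub (h.counting.measurable s)
  have hA : MeasurableSet {ω | X s ω = k} := h.counting.measurable s (measurableSet_singleton k)
  refine ⟨hmeas.aemeasurable, Measure.ext_of_singleton fun j => ?_⟩
  -- The subtraction is truncated, which is harmless because `X s ω ≤ X t ω` almost surely.
  have hae : ((fun ω => X t ω - X s ω) ⁻¹' {j} : Set Ω) =ᵐ[cond P {ω | X s ω = k}]
      {ω | X t ω = k + j} := by
    filter_upwards [ae_cond_of_forall_mem hA (p := fun ω => X s ω = k) fun ω hω => hω,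
      cond_absolutelyContinuous.ae_le h.counting.mono] with ω h1 h2
    have h3 : X s ω ≤ X t ω := h2 hst
    refine propext ?_
    change X t ω - X s ω = j ↔ X t ω = k + j
    omega
  rw [Measure.map_apply hmeas (measurableSet_singleton j), measure_congr hae,
    h.cond_apply_eq_polyaTransition ha hb hst hk, negBinomialMeasure_singleton, polyaTransition,
    if_pos (Nat.le_add_right k j), Nat.add_sub_cancel_left]

end IsMixedPoissonProcess

/-! ### Application to the negative binomial prior. -/

theorem IsUniformPacing.isMixedPoisson {Ω : Type*} [MeasurableSpace Ω] {P : Measure Ω}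
    [IsFiniteMeasure P] {a q : ℝ} (ha : 0 < a) (hq0 : 0 < q) (hq1 : q < 1) {N : Ω → ℕ}
    {U : ℕ → Ω → ℝ} (h : IsUniformPacing P (negBinomialMeasure a q) N U) :
    IsMixedPoissonProcess (mixedBinomialProcess N U) (gammaMeasure a (q⁻¹ - 1)) P where
  counting := h.isSimpleCounting
  rate_prob := isProbabilityMeasure_gammaMeasure ha (sub_pos.2 ((one_lt_inv₀ hq0).2 hq1))
  rate_nonneg := ae_nonneg_gammaMeasure _ _
  increments m τ hτ k := by
    have hb : 0 < q⁻¹ - 1 := sub_pos.2 ((one_lt_inv₀ hq0).2 hq1)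
    refine h.measure_increments (fun n => ?_) hτ k
    -- At `T = 1` the mixture has parameter `1 / (b + 1)`, which equals `q` exactly when `b = q⁻¹ -
    -- 1`.
    have h1 := lintegral_poissonMeasure_gammaMeasure ha hb zero_le_one n
    have h2 := negBinomialWeight_eq_gammaMoment ha hb zero_le_one n
    rw [sub_add_cancel, one_div, inv_inv] at h2
    simp only [mul_one] at h1
    rw [h1, ← h2, negBinomialMeasure_singleton]

theorem mainTheorem5 {Ω : Type*} [MeasurableSpace Ω] (P : Measure Ω) [IsProbabilityMeasure P]
    (ν q : ℝ) (hν : 0 < ν) (hq0 : 0 < q) (hq1 : q < 1)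
    (N : Ω → ℕ) (U : ℕ → Ω → ℝ)
    (h : IsUniformPacing P (negBinomialMeasure ν q) N U) :
    (∀ t : unitInterval,
      HasLaw (mixedBinomialProcess N U t)
        (negBinomialMeasure ν (q * (t : ℝ) / (1 - q + q * (t : ℝ)))) P) ∧
    (∀ (t : unitInterval) (k : ℕ), P {ω | mixedBinomialProcess N U t ω = k} ≠ 0 →
      HasLaw (fun ω => N ω - mixedBinomialProcess N U t ω)
        (negBinomialMeasure (ν + (k : ℝ)) (q * (1 - (t : ℝ))))
        (cond P {ω | mixedBinomialProcess N U t ω = k})) ∧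
    IsBirthProcess (mixedBinomialProcess N U)
      (fun t k => ((k : ℝ) + ν) / (t + q⁻¹ - 1)) P ∧
    IsMixedPoissonProcess (mixedBinomialProcess N U) (gammaMeasure ν (q⁻¹ - 1)) P := by
  have hb : 0 < q⁻¹ - 1 := sub_pos.2 ((one_lt_inv₀ hq0).2 hq1)
  have hX := h.isMixedPoisson hν hq0 hq1
  refine ⟨fun t => ?_, fun t k hk => ?_, ?_, hX⟩
  · have h1 := hX.hasLaw_negBinomialMeasure hν hb t
    have h2 : (t : ℝ) / (q⁻¹ - 1 + t) = q * t / (1 - q + q * t) := by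
      rw [← mul_div_mul_left _ _ hq0.ne']
      congr 1
      field_simp
    rwa [h2] at h1
  -- The remaining points are the increment up to time `1`, where the process equals `N` almost
  -- surely, and `b + 1 = q⁻¹`.
  · have h1 := hX.hasLaw_sub_cond hν hb (unitInterval.le_one' : t ≤ 1) hk
    have h2 : (((1 : unitInterval) : ℝ) - t) / (q⁻¹ - 1 + ((1 : unitInterval) : ℝ)) =
        q * (1 - t) := by
      rw [Set.Icc.coe_one, sub_add_cancel, div_inv_eq_mul, mul_comm]
    rw [h2] at h1
    refine h1.congr ?_
    filter_upwards [cond_absolutelyContinuous.ae_le h.ae_process_one] with ω hω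
    rw [hω]
  · simpa only [add_sub_assoc] using hX.isBirth hν hb
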